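/- Let $J(w)=\frac12\left(w+\frac1w\right)$, $w\in\mathbb C\setminus\{0\}$, be the Joukowsky transform. Its restriction $J_+$ to $\{|w|\ge 1\}\setminus\{e^{i\theta}:-\pi<\theta<0\}$ and its restriction $J_-$ to $\{0<|w|<1\}\cup\{e^{i\theta}:-\pi\le\theta\le0\}$ are bijections onto $\mathbb C$; let $T_\pm=J_\pm^{-1}$. For $\rho>1$ let $E_\rho$ be the interior of the ellipse $\frac{4x^2}{(\rho+\rho^{-1})^2}+\frac{4y^2}{(\rho-\rho^{-1})^2}=1$, let $\nu$ be the outward unit normal to $\partial E_\rho$ and $\sigma$ the length measure on $\partial E_\rho$. **Theorem.** Fix $\rho>1$ and let $f:\partial E_\rho\to\mathbb R$ be continuous with $\int_{\partial E_\rho}f\,d\sigma=0$. Let $U$ be a solution of the Neumann problem $\Delta U=0$ in $E_\rho$, $\frac{\partial U}{\partial\nu}=f$ on $\partial E_\rho$, that is, $U\in C^2(E_\rho)$ is harmonic, $\nabla U$ extends continuously to $\overline{E_\rho}$, and $\langle\nabla U,\nu\rangle=f$ on $\partial E_\rho$; assume moreover $U(1)=0$. Then the Dirichlet problem on the annulus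 $\{\frac1\rho<|w|<\rho\}$ with boundary values $$u=\varphi_-:=-\frac{f\circ J}{\rho\,|T_-'\circ J|}\ \text{ on } |w|=\tfrac1\rho,\qquad u=\varphi_+:=\rho\,\frac{f\circ J}{|T_+'\circ J|}\ \text{ on } |w|=\rho$$ has a solution ($u$ harmonic in the annulus and continuous on its closure), and for its solution $u$ and every $z\in E_\rho$, writing $T_+(z)=R(z)e^{i\Theta(z)}$ with $\Theta(z)\in(-\pi,\pi]$, $$U(z)=\int_{1/R(z)}^1\frac{u(tT_+(z))}{t}\,dt-\Theta(z)\int_0^1\int_0^{t\Theta(z)}\frac{\partial u}{\partial a_\tau}(e^{i\tau})\,d\tau\,dt ,$$ where $\frac{\partial u}{\partial a_\tau}(e^{i\tau})$ is the derivative of $u$ at $e^{i\tau}$ in the direction $a_\tau=(\cos\tau,\sin\tau)$. -/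

import Mathlib

noncomputable section

/-- The Joukowsky transform `J(w) = (w + 1/w)/2`. -/
def joukowsky (w : ℂ) : ℂ := (w + w⁻¹) / 2

/-- The closed exterior of the unit disk without the open lower half of the unit circle
`{e^{iθ} | -π < θ < 0}`: the domain of the branch `J₊`. -/
def joukowskyDomPlus : Set ℂ := {w | 1 ≤ ‖w‖} \ {w | ‖w‖ = 1 ∧ w.im < 0}

/-- The punctured open unit disk together with the closed lower half of the unit circle
`{e^{iθ} | -π ≤ θ ≤ 0}`: the domain of the branch `J₋`. -/
def joukowskyDomMinus : Set ℂ := {w | 0 < ‖w‖ ∧ ‖w‖ < 1} ∪ {w | ‖w‖ = 1 ∧ w.im ≤ 0}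

/-- `T₊`, the inverse of the restriction `J₊` of `J` to `joukowskyDomPlus`. -/
def joukowskyInvPlus : ℂ → ℂ := Function.invFunOn joukowsky joukowskyDomPlus

/-- `T₋`, the inverse of the restriction `J₋` of `J` to `joukowskyDomMinus`. -/
def joukowskyInvMinus : ℂ → ℂ := Function.invFunOn joukowsky joukowskyDomMinus

theorem joukowsky_inv (w : ℂ) : joukowsky w⁻¹ = joukowsky w := by
  simp [joukowsky, add_comm]

theorem eq_or_mul_eq_one_of_joukowsky_eq {w v : ℂ} (hw : w ≠ 0) (hv : v ≠ 0)
    (h : joukowsky w = joukowsky v) : w = v ∨ w * v = 1 := by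
  unfold joukowsky at h
  have h2 : (w - v) * (w * v - 1) = 0 := by
    field_simp at h
    linear_combination h
  rcases mul_eq_zero.1 h2 with h3 | h3
  · exact Or.inl (sub_eq_zero.1 h3)
  · exact Or.inr (sub_eq_zero.1 h3)

theorem exists_joukowsky_eq (z : ℂ) : ∃ w : ℂ, w ≠ 0 ∧ joukowsky w = z := by
  obtain ⟨s, hs⟩ := IsAlgClosed.exists_pow_nat_eq (z ^ 2 - 1) (n := 2) (by norm_num)
  have h1 : (z + s) * (z - s) = 1 := by linear_combination -hs
  have h0 : z + s ≠ 0 := left_ne_zero_of_mul_eq_one h1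
  refine ⟨z + s, h0, ?_⟩
  rw [joukowsky, inv_eq_of_mul_eq_one_right h1]
  ring

theorem inv_im_of_norm_eq_one {w : ℂ} (hw : ‖w‖ = 1) : (w⁻¹).im = -w.im := by
  rw [Complex.inv_im, Complex.normSq_eq_norm_sq, hw]
  simp

/-- `J₊` is a bijection onto `ℂ`, so `T₊` is defined on all of `ℂ`. -/
theorem joukowsky_bijOn_plus : Set.BijOn joukowsky joukowskyDomPlus Set.univ := by
  refine ⟨fun _ _ => Set.mem_univ _, ?_, ?_⟩
  · rintro w ⟨hw, hw'⟩ v ⟨hv, hv'⟩ h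
    simp only [Set.mem_ofPred_eq, not_and, not_lt] at hw hw' hv hv'
    have hw0 : w ≠ 0 := norm_pos_iff.1 (by linarith)
    have hv0 : v ≠ 0 := norm_pos_iff.1 (by linarith)
    rcases eq_or_mul_eq_one_of_joukowsky_eq hw0 hv0 h with h1 | h1
    · exact h1
    · have hn : ‖w‖ * ‖v‖ = 1 := by rw [← norm_mul, h1, norm_one]
      have hw1 : ‖w‖ = 1 := by nlinarith
      have hv1 : ‖v‖ = 1 := by nlinarith
      have hvw : w⁻¹ = v := inv_eq_of_mul_eq_one_right h1
      have him := inv_im_of_norm_eq_one hw1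
      rw [hvw] at him
      have h0 : w.im = 0 := by linarith [hw' hw1, hv' hv1]
      have hww : w * w = 1 := by
        have hre : w.re * w.re = 1 := by
          have := Complex.sq_norm w
          rw [hw1, Complex.normSq_apply, h0] at this
          linarith
        apply Complex.ext <;> simp [h0, hre]
      exact mul_left_cancel₀ hw0 (hww.trans h1.symm)
  · intro z _
    obtain ⟨w, hw, rfl⟩ := exists_joukowsky_eq z
    have key : w ∈ joukowskyDomPlus ∨ w⁻¹ ∈ joukowskyDomPlus := by
      simp only [joukowskyDomPlus, Set.mem_sdiff, Set.mem_ofPred_eq, not_and, not_lt, norm_inv]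
      rcases lt_trichotomy ‖w‖ 1 with h | h | h
      · have : 1 < ‖w‖⁻¹ := (one_lt_inv₀ (norm_pos_iff.2 hw)).2 h
        exact Or.inr ⟨this.le, fun h' => absurd h' this.ne'⟩
      · rcases le_total 0 w.im with h2 | h2
        · exact Or.inl ⟨h.ge, fun _ => h2⟩
        · refine Or.inr ⟨by simp [h], fun _ => ?_⟩
          rw [inv_im_of_norm_eq_one h]
          linarith
      · exact Or.inl ⟨h.le, fun h' => absurd h' h.ne'⟩
    rcases key with h | h
    · exact ⟨w, h, rfl⟩
    · exact ⟨w⁻¹, h, joukowsky_inv w⟩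

/-- `w ↦ 1/w` exchanges the two domains, except that both contain `±1`; hence `J₋` is a
bijection onto `ℂ` too and `T₋` is defined on all of `ℂ`. -/
theorem joukowsky_bijOn_minus : Set.BijOn joukowsky joukowskyDomMinus Set.univ := by
  have hiff : ∀ w : ℂ, w ∈ joukowskyDomMinus → w ≠ 0 ∧ w⁻¹ ∈ joukowskyDomPlus := by
    rintro w (⟨h0, h1⟩ | ⟨h1, h2⟩)
    · have : 1 < ‖w‖⁻¹ := (one_lt_inv₀ h0).2 h1
      refine ⟨norm_pos_iff.1 h0, ?_⟩
      simp only [joukowskyDomPlus, Set.mem_sdiff, Set.mem_ofPred_eq, not_and, not_lt, norm_inv]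
      exact ⟨this.le, fun h' => absurd h' this.ne'⟩
    · refine ⟨norm_pos_iff.1 (by linarith), ?_⟩
      simp only [joukowskyDomPlus, Set.mem_sdiff, Set.mem_ofPred_eq, not_and, not_lt, norm_inv]
      refine ⟨by simp [h1], fun _ => ?_⟩
      rw [inv_im_of_norm_eq_one h1]
      linarith
  refine ⟨fun _ _ => Set.mem_univ _, ?_, ?_⟩
  · intro w hw v hv h
    refine inv_injective (joukowsky_bijOn_plus.injOn (hiff w hw).2 (hiff v hv).2 ?_)
    rw [joukowsky_inv, joukowsky_inv, h]
  · intro z _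
    obtain ⟨w, ⟨hw1, hw2⟩, rfl⟩ := joukowsky_bijOn_plus.surjOn (Set.mem_univ z)
    simp only [Set.mem_ofPred_eq, not_and, not_lt] at hw1 hw2
    have hw0 : 0 < ‖w‖ := by linarith
    refine ⟨w⁻¹, ?_, joukowsky_inv w⟩
    rcases hw1.lt_or_eq with h | h
    · refine Or.inl ⟨by simpa using norm_pos_iff.1 hw0, ?_⟩
      rw [norm_inv]
      exact inv_lt_one_of_one_lt₀ h
    · refine Or.inr ⟨by simp [← h], ?_⟩
      rw [inv_im_of_norm_eq_one h.symm]
      linarith [hw2 h.symm]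

/-- `E_ρ`, the interior of the ellipse with semi-axes `(ρ + 1/ρ)/2` and `(ρ - 1/ρ)/2`. -/
def ellipseRegion (ρ : ℝ) : Set ℂ :=
  {z | 4 * z.re ^ 2 / (ρ + ρ⁻¹) ^ 2 + 4 * z.im ^ 2 / (ρ - ρ⁻¹) ^ 2 < 1}

/-- The outward unit normal to `∂E_ρ` at `z`: the normalized gradient of the quadratic form that
defines `E_ρ` (up to the factor `2`). -/
def ellipseNormal (ρ : ℝ) (z : ℂ) : ℂ :=
  let v : ℂ := ⟨4 * z.re / (ρ + ρ⁻¹) ^ 2, 4 * z.im / (ρ - ρ⁻¹) ^ 2⟩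
  (‖v‖⁻¹ : ℝ) • v

/-- The open annulus `{r₁ < |w| < r₂}`. -/
def openAnnulus (r₁ r₂ : ℝ) : Set ℂ := {w | r₁ < ‖w‖ ∧ ‖w‖ < r₂}

/-- `u ∈ C²(D) ∩ C⁰(closure D)`, `Δu = 0` in `D` and `u = g` on `∂D`. -/
structure IsDirichletSolution (D : Set ℂ) (g u : ℂ → ℝ) : Prop where
  harmonic : InnerProductSpace.HarmonicOnNhd u D
  continuousOn : ContinuousOn u (closure D)
  boundary : ∀ z ∈ frontier D, u z = g z

/-- `U ∈ C²(D) ∩ C¹(closure D)`, `ΔU = 0` in `D` and `∂U/∂ν = f` on `∂D`, where `ν` is the outward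
unit normal. `U ∈ C¹(closure D)` means that `∇U` extends continuously to `closure D`, and
`∂U/∂ν` is the inner product of this extension with `ν`. -/
structure IsNeumannSolution (D : Set ℂ) (ν : ℂ → ℂ) (f U : ℂ → ℝ) : Prop where
  harmonic : InnerProductSpace.HarmonicOnNhd U D
  boundary : ∃ G : ℂ → ℂ, ContinuousOn G (closure D) ∧ (∀ z ∈ D, HasGradientAt U (G z) z) ∧
    ∀ z ∈ frontier D, inner ℝ (G z) (ν z) = f z

/-- The boundary data on `{|w| = 1/ρ} ∪ {|w| = ρ}`: `ρ f(J(w)) / |T₊'(J(w))|` on the outer circle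
and `-f(J(w)) / (ρ |T₋'(J(w))|)` on the inner circle. The minus sign comes from `J` carrying the
radially increasing direction on the inner circle to the inward normal of the ellipse. -/
def annulusData (ρ : ℝ) (f : ℂ → ℝ) (w : ℂ) : ℝ :=
  if ‖w‖ = ρ then ρ * f (joukowsky w) / ‖deriv joukowskyInvPlus (joukowsky w)‖
  else -(f (joukowsky w) / (ρ * ‖deriv joukowskyInvMinus (joukowsky w)‖))

/-- The derivative `∂u/∂a_τ` at `e^{iτ}`, in the direction of the unit vector
`a_τ = (cos τ, sin τ)`. -/
def radialDeriv (u : ℂ → ℝ) (τ : ℝ) : ℝ :=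
  lineDeriv ℝ u (Complex.exp (τ * Complex.I)) (Complex.exp (τ * Complex.I))

end

open Complex Filter Topology InnerProductSpace ComplexConjugate

/-! With `G` the gradient of `U`, put H(w) = conj(G(J(w))) · wJ'(w) (`pullbackGradient`). Since conj
G = U_x - iU_y is holomorphic and J maps the annulus into E_ρ, H is holomorphic on the annulus, and
in polar coordinates Re H = r∂_r(U∘J), Im H = -∂_θ(U∘J). On the boundary circles wJ'(w) is normal to
the ellipse, so Re H has the prescribed boundary values (`isDirichletSolution_pullbackGradient_re`).
This gives existence, and the maximum principle (`IsDirichletSolution.eqOn`) gives u = Re H in the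
annulus for every solution u.

It remains to integrate d(U∘J) from 1, where U∘J vanishes, along the unit circle to e^{iΘ} and then
along the ray to T₊(z). The ray contributes the integral of u(tT₊(z))/t. On the circle,
Cauchy-Riemann gives ∂_r u = ∂_θ Im H, and Im H(1) = 0 because wJ'(w) vanishes at 1. Hence the inner
integral is Im H(e^{itΘ}) (`integral_radialDeriv`), and Θ times its integral over t is
-U(J(e^{iΘ})). -/

/-! ### Maximum principle and uniqueness for the Dirichlet problem -/

/-- A real function that is harmonic near `q` and has a local maximum at `q` is constant near `q`. -/
theorem HarmonicAt.eventually_eq_of_isLocalMax {h : ℂ → ℝ} {q : ℂ} (hh : HarmonicAt h q)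
    (hmax : IsLocalMax h q) : ∀ᶠ y in 𝓝 q, h y = h q := by
  obtain ⟨ε, hε, hball⟩ := Metric.isOpen_iff.1 (isOpen_setOfPred_harmonicAt (f := h)) q hh
  obtain ⟨F, hF, hFre⟩ := HarmonicOnNhd.exists_analyticOnNhd_ball_re_eq
    (fun _ hy => hball hy)
  have hmem := Metric.ball_mem_nhds q hε
  have hnorm : ∀ y ∈ Metric.ball q ε, ‖exp (F y)‖ = Real.exp (h y) := fun y hy => by
    rw [norm_exp, ← hFre hy]
  -- With h = Re F near q, |exp F| = exp h, so the maximum modulus principle applies to exp F.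
  have hd : ∀ᶠ y in 𝓝 q, DifferentiableAt ℂ (fun y => exp (F y)) y := by
    filter_upwards [hmem] with y hy using (hF y hy).differentiableAt.cexp
  have hm : IsLocalMax (norm ∘ fun y => exp (F y)) q := by
    filter_upwards [hmem, hmax] with y hy hy'
    simp only [Function.comp_apply]
    rw [hnorm y hy, hnorm q (Metric.mem_ball_self hε)]
    exact Real.exp_le_exp.2 hy'
  filter_upwards [hmem, Complex.norm_eventually_eq_of_isLocalMax hd hm] with y hy hy'
  rw [hnorm y hy, hnorm q (Metric.mem_ball_self hε)] at hy'
  exact Real.exp_injective hy'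

/-- Maximum principle for harmonic functions on a bounded open set. -/
theorem HarmonicOnNhd.nonpos_of_frontier {D : Set ℂ} (hD : IsOpen D)
    (hb : Bornology.IsBounded D) {h : ℂ → ℝ} (hh : HarmonicOnNhd h D)
    (hc : ContinuousOn h (closure D)) (hfr : ∀ z ∈ frontier D, h z ≤ 0) :
    ∀ z ∈ D, h z ≤ 0 := by
  intro z hz
  have hK : IsCompact (closure D) := hb.isCompact_closure
  obtain ⟨p, hp, hpmax⟩ := hK.exists_isMaxOn ⟨z, subset_closure hz⟩ hc
  refine (hpmax (subset_closure hz)).trans (not_lt.1 fun hpos => ?_)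
  -- Take q with largest real part among the maximum points. It is interior since h q > 0, so h is
  -- constant near q, and points just to the right of q are maximum points too: a contradiction.
  have hM : IsCompact (closure D ∩ h ⁻¹' {h p}) :=
    hK.of_isClosed_subset (hc.preimage_isClosed_of_isClosed isClosed_closure isClosed_singleton)
      Set.inter_subset_left
  obtain ⟨q, ⟨hq, hqp⟩, hqmax⟩ := hM.exists_isMaxOn ⟨p, hp, rfl⟩ continuous_re.continuousOn
  simp only [Set.mem_preimage, Set.mem_singleton_iff] at hqp
  have hqD : q ∈ D := by
    by_contra hn
    have := hfr q ⟨hq, by rwa [hD.interior_eq]⟩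
    linarith
  have hloc : IsLocalMax h q := by
    filter_upwards [hD.mem_nhds hqD] with y hy
    rw [hqp]
    exact hpmax (subset_closure hy)
  have hev : ∀ᶠ y in 𝓝 q, y.re ≤ q.re := by
    filter_upwards [HarmonicAt.eventually_eq_of_isLocalMax (hh q hqD) hloc, hD.mem_nhds hqD] with y hy hyD
    exact hqmax ⟨subset_closure hyD, by simp [hy, hqp]⟩
  have hcont : Tendsto (fun t : ℝ => q + t) (𝓝[>] 0) (𝓝 q) := by
    have : Continuous fun t : ℝ => q + t := by fun_prop
    have h0 := this.tendsto 0
    simp only [ofReal_zero, add_zero] at h0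
    exact h0.mono_left nhdsWithin_le_nhds
  obtain ⟨t, ht, ht0⟩ := ((hcont.eventually hev).and self_mem_nhdsWithin).exists
  simp only [add_re, ofReal_re] at ht ht0
  linarith

/-- The Dirichlet problem on a bounded open set has at most one solution. -/
theorem IsDirichletSolution.eqOn {D : Set ℂ} (hD : IsOpen D) (hb : Bornology.IsBounded D)
    {g u v : ℂ → ℝ} (hu : IsDirichletSolution D g u) (hv : IsDirichletSolution D g v) :
    Set.EqOn u v D := by
  have key : ∀ {u v : ℂ → ℝ}, IsDirichletSolution D g u → IsDirichletSolution D g v →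
      ∀ z ∈ D, u z ≤ v z := by
    intro u v hu hv z hz
    refine sub_nonpos.1 (HarmonicOnNhd.nonpos_of_frontier hD hb
      (hu.harmonic.sub hv.harmonic) (hu.continuousOn.sub hv.continuousOn) (fun z hz => ?_) z hz)
    simp [hu.boundary z hz, hv.boundary z hz]
  exact fun z hz => le_antisymm (key hu hv z hz) (key hv hu z hz)

/-! ### The annulus as the preimage of the ellipse under J -/

theorem isOpen_openAnnulus (r₁ r₂ : ℝ) : IsOpen (openAnnulus r₁ r₂) :=
  (isOpen_lt continuous_const continuous_norm).inter (isOpen_lt continuous_norm continuous_const)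

theorem isBounded_openAnnulus (r₁ r₂ : ℝ) : Bornology.IsBounded (openAnnulus r₁ r₂) :=
  Metric.isBounded_ball.subset fun _ hw => mem_ball_zero_iff.2 hw.2

theorem closure_openAnnulus_subset (r₁ r₂ : ℝ) :
    closure (openAnnulus r₁ r₂) ⊆ {w | r₁ ≤ ‖w‖ ∧ ‖w‖ ≤ r₂} :=
  closure_minimal (fun _ hw => ⟨hw.1.le, hw.2.le⟩)
    ((isClosed_le continuous_const continuous_norm).inter
      (isClosed_le continuous_norm continuous_const))

theorem norm_eq_of_mem_frontier_openAnnulus {r₁ r₂ : ℝ} {w : ℂ}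
    (hw : w ∈ frontier (openAnnulus r₁ r₂)) : ‖w‖ = r₁ ∨ ‖w‖ = r₂ := by
  rw [(isOpen_openAnnulus r₁ r₂).frontier_eq] at hw
  obtain ⟨h1, h2⟩ := closure_openAnnulus_subset r₁ r₂ hw.1
  rcases h1.eq_or_lt with h | h
  · exact Or.inl h.symm
  · exact Or.inr (h2.eq_or_lt.resolve_right fun h' => hw.2 ⟨h, h'⟩)

theorem isOpen_ellipseRegion (ρ : ℝ) : IsOpen (ellipseRegion ρ) :=
  isOpen_lt (by fun_prop) continuous_const

theorem joukowsky_re (w : ℂ) : (joukowsky w).re = w.re * (1 + (normSq w)⁻¹) / 2 := by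
  simp [joukowsky, inv_re]
  ring

theorem joukowsky_im (w : ℂ) : (joukowsky w).im = w.im * (1 - (normSq w)⁻¹) / 2 := by
  simp [joukowsky, inv_im]
  ring

theorem add_inv_lt_add_inv_iff {s S : ℝ} (hs : 0 < s) (hS : 1 < S) :
    s + s⁻¹ < S + S⁻¹ ↔ S⁻¹ < s ∧ s < S := by
  have hS0 : 0 < S := by linarith
  have h1 : S⁻¹ < 1 := inv_lt_one_of_one_lt₀ hS
  have hSS : S * S⁻¹ = 1 := mul_inv_cancel₀ hS0.ne'
  have key : s * (S + S⁻¹ - (s + s⁻¹)) = (s - S⁻¹) * (S - s) := by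
    field_simp
    ring
  rw [← sub_pos, ← mul_pos_iff_of_pos_left hs, key, mul_pos_iff]
  constructor
  · rintro (h | h)
    · exact ⟨by linarith, by linarith⟩
    · linarith
  · exact fun h => Or.inl ⟨by linarith, by linarith⟩

/-- With s = |w|² and p = s + 1/s, both conditions amount to p < P = ρ² + ρ⁻²: one minus the
quadratic form of the ellipse at J(w) is P - p times a positive factor. -/
theorem joukowsky_mem_ellipseRegion_iff {ρ : ℝ} (hρ : 1 < ρ) {w : ℂ} (hw : w ≠ 0) :
    joukowsky w ∈ ellipseRegion ρ ↔ w ∈ openAnnulus ρ⁻¹ ρ := by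
  have hρ0 : 0 < ρ := by linarith
  have hs : 0 < normSq w := normSq_pos.2 hw
  have hS : 1 < ρ ^ 2 := by nlinarith
  have hiff : w ∈ openAnnulus ρ⁻¹ ρ ↔
      normSq w + (normSq w)⁻¹ < ρ ^ 2 + (ρ ^ 2)⁻¹ := by
    rw [add_inv_lt_add_inv_iff hs hS, normSq_eq_norm_sq, ← inv_pow,
      pow_lt_pow_iff_left₀ (by positivity) (by positivity) two_ne_zero,
      pow_lt_pow_iff_left₀ (by positivity) (by positivity) two_ne_zero]
    rfl
  have hsx : normSq w = w.re ^ 2 + w.im ^ 2 := by rw [normSq_apply]; ring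
  have hP : 2 < ρ ^ 2 + (ρ ^ 2)⁻¹ := by
    have h : ρ ^ 2 + (ρ ^ 2)⁻¹ - 2 = (ρ - ρ⁻¹) ^ 2 := by field_simp; ring
    have : 0 < ρ - ρ⁻¹ := by linarith [inv_lt_one_of_one_lt₀ hρ]
    nlinarith
  have e1 : (ρ + ρ⁻¹) ^ 2 = ρ ^ 2 + (ρ ^ 2)⁻¹ + 2 := by field_simp; ring
  have e2 : (ρ - ρ⁻¹) ^ 2 = ρ ^ 2 + (ρ ^ 2)⁻¹ - 2 := by field_simp; ring
  rw [hiff, ellipseRegion, Set.mem_ofPred_eq, joukowsky_re, joukowsky_im, e1, e2]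
  set P := ρ ^ 2 + (ρ ^ 2)⁻¹
  set s := normSq w
  have hx : 4 * (w.re * (1 + s⁻¹) / 2) ^ 2 = w.re ^ 2 / s * (s + s⁻¹ + 2) := by
    field_simp; ring
  have hy : 4 * (w.im * (1 - s⁻¹) / 2) ^ 2 = w.im ^ 2 / s * (s + s⁻¹ - 2) := by
    field_simp; ring
  have hxy : w.re ^ 2 / s + w.im ^ 2 / s = 1 := by
    rw [← add_div, ← hsx, div_self hs.ne']
  rw [hx, hy]
  have hx0 : 0 ≤ w.re ^ 2 / s := by positivity
  have hy0 : 0 ≤ w.im ^ 2 / s := by positivity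
  generalize w.re ^ 2 / s = x at *
  generalize w.im ^ 2 / s = y at *
  generalize s + s⁻¹ = p at *
  have hP1 : 0 < P + 2 := by linarith
  have hP2 : 0 < P - 2 := by linarith
  have key : 1 - (x * (p + 2) / (P + 2) + y * (p - 2) / (P - 2)) =
      (P - p) * (x / (P + 2) + y / (P - 2)) := by
    rw [← hxy]
    field_simp
    ring
  -- x and y are cos² and sin² of the argument of w, so they do not both vanish.
  have hpos : 0 < x / (P + 2) + y / (P - 2) := by
    rcases hx0.eq_or_lt with h | h
    · have : y = 1 := by linarith
      rw [← h, this]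
      simpa using hP2
    · exact add_pos_of_pos_of_nonneg (by positivity) (by positivity)
  rw [← sub_pos, key, mul_pos_iff_of_pos_right hpos, sub_pos]

/-! ### Derivatives of the inverse branches, and boundary correspondence -/

theorem hasStrictDerivAt_joukowsky {w : ℂ} (hw : w ≠ 0) :
    HasStrictDerivAt joukowsky ((1 - (w ^ 2)⁻¹) / 2) w := by
  have := ((hasStrictDerivAt_id w).add (hasStrictDerivAt_inv hw)).div_const 2
  rw [← sub_eq_add_neg] at this
  exact this

theorem joukowsky_deriv_ne_zero {w : ℂ} (hw : ‖w‖ ≠ 1) : (1 - (w ^ 2)⁻¹) / 2 ≠ 0 := by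
  intro h
  have h2 : (w ^ 2)⁻¹ = 1 := by linear_combination -2 * h
  have h3 : ‖w‖ ^ 2 = 1 := by rw [← norm_pow, inv_eq_one.1 h2, norm_one]
  exact hw ((pow_eq_one_iff_of_nonneg (norm_nonneg w) two_ne_zero).1 h3)

/-- The derivative of an inverse branch of `J` at the image of an interior point of its range. -/
theorem deriv_invFunOn_joukowsky {S : Set ℂ} (hS : Set.InjOn joukowsky S) {w : ℂ}
    (hwS : S ∈ 𝓝 w) (hw : w ≠ 0) (hw1 : ‖w‖ ≠ 1) :
    deriv (Function.invFunOn joukowsky S) (joukowsky w) = ((1 - (w ^ 2)⁻¹) / 2)⁻¹ := by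
  refine (HasStrictDerivAt.to_local_left_inverse (hasStrictDerivAt_joukowsky hw)
    (joukowsky_deriv_ne_zero hw1) ?_).hasDerivAt.deriv
  filter_upwards [hwS] with x hx using hS.leftInvOn_invFunOn hx

theorem deriv_joukowskyInvPlus {w : ℂ} (hw : 1 < ‖w‖) :
    deriv joukowskyInvPlus (joukowsky w) = ((1 - (w ^ 2)⁻¹) / 2)⁻¹ := by
  refine deriv_invFunOn_joukowsky joukowsky_bijOn_plus.injOn ?_
    (norm_pos_iff.1 (by linarith)) hw.ne'
  filter_upwards [(isOpen_lt continuous_const continuous_norm).mem_nhds hw] with x hx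
  exact ⟨le_of_lt hx, fun h => ne_of_gt hx h.1⟩

theorem deriv_joukowskyInvMinus {w : ℂ} (hw0 : w ≠ 0) (hw : ‖w‖ < 1) :
    deriv joukowskyInvMinus (joukowsky w) = ((1 - (w ^ 2)⁻¹) / 2)⁻¹ := by
  refine deriv_invFunOn_joukowsky joukowsky_bijOn_minus.injOn ?_ hw0 hw.ne
  filter_upwards [(isOpen_lt continuous_norm continuous_const).mem_nhds hw,
    isOpen_ne.mem_nhds hw0] with x hx hx0
  exact Or.inl ⟨norm_pos_iff.2 hx0, hx⟩

theorem continuousOn_joukowsky : ContinuousOn joukowsky {0}ᶜ := fun _ hw =>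
  (hasStrictDerivAt_joukowsky hw).hasDerivAt.continuousAt.continuousWithinAt

theorem ne_zero_of_mem_closure_openAnnulus {r₁ r₂ : ℝ} (hr : 0 < r₁) {w : ℂ}
    (hw : w ∈ closure (openAnnulus r₁ r₂)) : w ≠ 0 :=
  norm_pos_iff.1 (hr.trans_le (closure_openAnnulus_subset _ _ hw).1)

theorem joukowsky_mapsTo_closure {ρ : ℝ} (hρ : 1 < ρ) :
    Set.MapsTo joukowsky (closure (openAnnulus ρ⁻¹ ρ)) (closure (ellipseRegion ρ)) := by
  have hi : 0 < ρ⁻¹ := by positivity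
  refine Set.MapsTo.closure_of_continuousOn (fun w hw => ?_)
    (continuousOn_joukowsky.mono fun w hw => ne_zero_of_mem_closure_openAnnulus hi hw)
  exact (joukowsky_mem_ellipseRegion_iff hρ
    (ne_zero_of_mem_closure_openAnnulus hi (subset_closure hw))).2 hw

theorem joukowsky_mem_frontier {ρ : ℝ} (hρ : 1 < ρ) {w : ℂ}
    (hw : w ∈ frontier (openAnnulus ρ⁻¹ ρ)) : joukowsky w ∈ frontier (ellipseRegion ρ) := by
  rw [(isOpen_openAnnulus _ _).frontier_eq] at hw
  rw [(isOpen_ellipseRegion ρ).frontier_eq]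
  refine ⟨joukowsky_mapsTo_closure hρ hw.1, fun h => hw.2 ?_⟩
  exact (joukowsky_mem_ellipseRegion_iff hρ
    (ne_zero_of_mem_closure_openAnnulus (by positivity) hw.1)).1 h

/-! ### Normal direction, pulled-back gradient and boundary values -/

/-- On `|w| = ρ` the vector `w J'(w) = (w - 1/w)/2` is a positive multiple of the outward normal
of the ellipse at `J(w)`. -/
theorem norm_smul_ellipseNormal_joukowsky {ρ : ℝ} (hρ : 1 < ρ) {w : ℂ} (hw : ‖w‖ = ρ) :
    (‖(w - w⁻¹) / 2‖ : ℝ) • ellipseNormal ρ (joukowsky w) = (w - w⁻¹) / 2 := by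
  have hρ0 : 0 < ρ := by linarith
  have h1 : 0 < ρ - ρ⁻¹ := by linarith [inv_lt_one_of_one_lt₀ hρ]
  have hw0 : w ≠ 0 := norm_pos_iff.1 (by linarith)
  have hs : normSq w = ρ ^ 2 := by rw [normSq_eq_norm_sq, hw]
  set n : ℂ := (w - w⁻¹) / 2 with hn
  have hn0 : n ≠ 0 := by
    have : n = w * ((1 - (w ^ 2)⁻¹) / 2) := by rw [hn]; field_simp
    rw [this]
    exact mul_ne_zero hw0 (joukowsky_deriv_ne_zero (by rw [hw]; exact hρ.ne'))
  -- With semi-axes a, b and w = ρe^{iθ}, n = (b cos θ, a sin θ), while the unnormalized normal at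
  -- J(w) is (cos θ / a, sin θ / b); their ratio is 1/(ab).
  set c : ℝ := 4 / ((ρ + ρ⁻¹) * (ρ - ρ⁻¹)) with hc
  have hc0 : 0 < c := by positivity
  have hv : (⟨4 * (joukowsky w).re / (ρ + ρ⁻¹) ^ 2, 4 * (joukowsky w).im / (ρ - ρ⁻¹) ^ 2⟩ : ℂ)
      = c • n := by
    have hρ2 : ρ ^ 2 - 1 ≠ 0 := by nlinarith
    have hre : n.re = w.re * (1 - (ρ ^ 2)⁻¹) / 2 := by
      rw [hn, ← hs]; simp [inv_re]; ring
    have him : n.im = w.im * (1 + (ρ ^ 2)⁻¹) / 2 := by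
      rw [hn, ← hs]; simp [inv_im]; ring
    have ea : ρ + ρ⁻¹ = (ρ ^ 2 + 1) / ρ := by field_simp
    have eb : ρ - ρ⁻¹ = (ρ ^ 2 - 1) / ρ := by field_simp
    apply Complex.ext
    · rw [joukowsky_re, hs, smul_re, smul_eq_mul, hre, hc, ea, eb]
      field_simp
    · rw [joukowsky_im, hs, smul_im, smul_eq_mul, him, hc, ea, eb]
      field_simp
  have hnn : ‖n‖ ≠ 0 := norm_ne_zero_iff.2 hn0
  simp only [ellipseNormal]
  rw [hv, norm_smul, Real.norm_of_nonneg hc0.le, smul_smul, smul_smul]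
  have : ‖n‖ * ((c * ‖n‖)⁻¹ * c) = 1 := by field_simp
  rw [← mul_assoc] at this
  rw [this, one_smul]

/-- The function on the annulus whose real part is `r ∂ᵣ(U ∘ J)`, where `G` is the gradient
of `U`. -/
noncomputable def pullbackGradient (G : ℂ → ℂ) (w : ℂ) : ℂ := conj (G (joukowsky w)) * ((w - w⁻¹) / 2)

theorem pullbackGradient_re (G : ℂ → ℂ) (w : ℂ) :
    (pullbackGradient G w).re = inner ℝ (G (joukowsky w)) ((w - w⁻¹) / 2) := by
  rw [pullbackGradient, Complex.inner, mul_comm]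

theorem pullbackGradient_re_eq_annulusData {ρ : ℝ} (hρ : 1 < ρ) {f : ℂ → ℝ} {G : ℂ → ℂ}
    (hG : ∀ z ∈ frontier (ellipseRegion ρ), inner ℝ (G z) (ellipseNormal ρ z) = f z) {w : ℂ}
    (hw : w ∈ frontier (openAnnulus ρ⁻¹ ρ)) :
    (pullbackGradient G w).re = annulusData ρ f w := by
  have hρ0 : 0 < ρ := by linarith
  have hi : ρ⁻¹ < 1 := inv_lt_one_of_one_lt₀ hρ
  have hz := hG _ (joukowsky_mem_frontier hρ hw)
  have hw0 : w ≠ 0 := ne_zero_of_mem_closure_openAnnulus (by positivity) (frontier_subset_closure hw)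
  have hn : (w - w⁻¹) / 2 = w * ((1 - (w ^ 2)⁻¹) / 2) := by field_simp
  rw [pullbackGradient_re]
  rcases norm_eq_of_mem_frontier_openAnnulus hw with h | h
  · have hne : ‖w‖ ≠ ρ := by rw [h]; linarith
    -- The inner circle reduces to the outer one: J(1/w) = J(w), whereas (w - 1/w)/2 changes sign
    -- under inversion, whence the minus sign in the data.
    have hinv : ‖w⁻¹‖ = ρ := by rw [norm_inv, h, inv_inv]
    have hnu := norm_smul_ellipseNormal_joukowsky hρ hinv
    rw [joukowsky_inv, inv_inv] at hnu
    have hneg : (w - w⁻¹) / 2 = -((w⁻¹ - w) / 2) := by ring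
    rw [annulusData, if_neg hne, deriv_joukowskyInvMinus hw0 (by rw [h]; exact hi), hneg, ← hnu,
      inner_neg_right, inner_smul_right, hz, ← norm_neg, ← hneg, hn, norm_mul, h, norm_inv]
    field_simp
  · rw [annulusData, if_pos h, deriv_joukowskyInvPlus (by rw [h]; exact hρ),
      ← norm_smul_ellipseNormal_joukowsky hρ h, inner_smul_right, hz, hn, norm_mul, h, norm_inv]
    field_simp

/-- conj G = U_x - iU_y, and its Cauchy-Riemann equations are ΔU = 0 and the symmetry of second
derivatives. -/
theorem differentiableAt_conj_gradient {U : ℂ → ℝ} {G : ℂ → ℂ} {D : Set ℂ} (hD : IsOpen D)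
    (hU : HarmonicOnNhd U D) (hG : ∀ z ∈ D, HasGradientAt U (G z) z) {z : ℂ} (hz : z ∈ D) :
    DifferentiableAt ℂ (fun z => conj (G z)) z := by
  refine (HarmonicAt.differentiableAt_complex_partial (hU z hz)).congr_of_eventuallyEq ?_
  filter_upwards [hD.mem_nhds hz] with y hy
  rw [(hG y hy).hasFDerivAt.fderiv]
  apply Complex.ext <;> simp [InnerProductSpace.toDual_apply_apply, Complex.inner]

theorem differentiableOn_pullbackGradient {ρ : ℝ} (hρ : 1 < ρ) {U : ℂ → ℝ} {G : ℂ → ℂ}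
    (hU : HarmonicOnNhd U (ellipseRegion ρ))
    (hG : ∀ z ∈ ellipseRegion ρ, HasGradientAt U (G z) z) :
    DifferentiableOn ℂ (pullbackGradient G) (openAnnulus ρ⁻¹ ρ) := by
  intro w hw
  have hw0 : w ≠ 0 := ne_zero_of_mem_closure_openAnnulus (by positivity) (subset_closure hw)
  have h1 : DifferentiableAt ℂ (fun w => conj (G (joukowsky w))) w :=
    DifferentiableAt.comp (g := fun z => conj (G z)) w (differentiableAt_conj_gradient (isOpen_ellipseRegion ρ) hU hG
      ((joukowsky_mem_ellipseRegion_iff hρ hw0).2 hw))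
      (hasStrictDerivAt_joukowsky hw0).hasDerivAt.differentiableAt
  exact (h1.mul ((differentiableAt_id.sub (differentiableAt_inv hw0)).div_const 2)
    ).differentiableWithinAt

theorem isDirichletSolution_pullbackGradient_re {ρ : ℝ} (hρ : 1 < ρ) {f U : ℂ → ℝ} {G : ℂ → ℂ}
    (hU : HarmonicOnNhd U (ellipseRegion ρ)) (hGc : ContinuousOn G (closure (ellipseRegion ρ)))
    (hG : ∀ z ∈ ellipseRegion ρ, HasGradientAt U (G z) z)
    (hGf : ∀ z ∈ frontier (ellipseRegion ρ), inner ℝ (G z) (ellipseNormal ρ z) = f z) :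
    IsDirichletSolution (openAnnulus ρ⁻¹ ρ) (annulusData ρ f)
      (fun w => (pullbackGradient G w).re) where
  harmonic w hw := ((differentiableOn_pullbackGradient hρ hU hG).analyticAt
    ((isOpen_openAnnulus _ _).mem_nhds hw)).harmonicAt_re
  continuousOn := by
    have h0 : ∀ w ∈ closure (openAnnulus ρ⁻¹ ρ), w ≠ 0 := fun w hw =>
      ne_zero_of_mem_closure_openAnnulus (by positivity) hw
    have h1 : ContinuousOn (fun w => G (joukowsky w)) (closure (openAnnulus ρ⁻¹ ρ)) :=
      hGc.comp (continuousOn_joukowsky.mono h0) (joukowsky_mapsTo_closure hρ)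
    exact continuous_re.comp_continuousOn ((continuous_conj.comp_continuousOn h1).mul
      ((continuousOn_id.sub (continuousOn_id.inv₀ h0)).div_const 2))
  boundary w hw := pullbackGradient_re_eq_annulusData hρ hGf hw

/-! ### Integration along rays and along the unit circle -/

/-- The derivative of `U ∘ J` along a curve in the annulus. -/
theorem hasDerivAt_comp_joukowsky {ρ : ℝ} (hρ : 1 < ρ) {U : ℂ → ℝ} {G : ℂ → ℂ}
    (hG : ∀ z ∈ ellipseRegion ρ, HasGradientAt U (G z) z) {γ : ℝ → ℂ} {γ' : ℂ} {t : ℝ}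
    (hγ : HasDerivAt γ γ' t) (ht : γ t ∈ openAnnulus ρ⁻¹ ρ) :
    HasDerivAt (fun s => U (joukowsky (γ s))) (pullbackGradient G (γ t) * γ' / γ t).re t := by
  have hw0 : γ t ≠ 0 := ne_zero_of_mem_closure_openAnnulus (by positivity) (subset_closure ht)
  have h1 : HasDerivAt (fun s => joukowsky (γ s)) ((1 - (γ t ^ 2)⁻¹) / 2 * γ') t :=
    (hasStrictDerivAt_joukowsky hw0).hasDerivAt.comp t hγ
  have h2 := (hG _ ((joukowsky_mem_ellipseRegion_iff hρ hw0).2 ht)).hasFDerivAt.comp_hasDerivAt t h1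
  refine h2.congr_deriv ?_
  rw [InnerProductSpace.toDual_apply_apply, Complex.inner, pullbackGradient]
  congr 1
  field_simp

theorem hasDerivAt_exp_mul_I (τ : ℝ) :
    HasDerivAt (fun s : ℝ => exp (s * I)) (exp (τ * I) * I) τ := by
  simpa using ((hasDerivAt_id τ).ofReal_comp.mul_const I).cexp

theorem exp_mul_I_mem_openAnnulus {ρ : ℝ} (hρ : 1 < ρ) (τ : ℝ) :
    exp (τ * I) ∈ openAnnulus ρ⁻¹ ρ := by
  simp only [openAnnulus, Set.mem_ofPred_eq, norm_exp_ofReal_mul_I]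
  exact ⟨inv_lt_one_of_one_lt₀ hρ, hρ⟩

theorem radialDeriv_eq {ρ : ℝ} (hρ : 1 < ρ) {u : ℂ → ℝ} {H : ℂ → ℂ}
    (hH : DifferentiableOn ℂ H (openAnnulus ρ⁻¹ ρ))
    (hu : Set.EqOn u (fun w => (H w).re) (openAnnulus ρ⁻¹ ρ)) (τ : ℝ) :
    radialDeriv u τ = (deriv H (exp (τ * I)) * exp (τ * I)).re := by
  have hn := (isOpen_openAnnulus ρ⁻¹ ρ).mem_nhds (exp_mul_I_mem_openAnnulus hρ τ)
  have h1 := (hH.differentiableAt hn).hasDerivAt.hasFDerivAt.restrictScalars ℝ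
  have h2 := (reCLM.hasFDerivAt.comp _ h1).congr_of_eventuallyEq
    (f₁ := u) (by filter_upwards [hn] with y hy using hu hy)
  rw [radialDeriv, (h2.hasLineDerivAt _).lineDeriv]
  simp [mul_comm]

/-- On the unit circle both ∂_r Re H and ∂_θ Im H equal Re(wH'(w)). -/
theorem integral_radialDeriv {ρ : ℝ} (hρ : 1 < ρ) {u : ℂ → ℝ} {H : ℂ → ℂ}
    (hH : DifferentiableOn ℂ H (openAnnulus ρ⁻¹ ρ))
    (hu : Set.EqOn u (fun w => (H w).re) (openAnnulus ρ⁻¹ ρ)) (a b : ℝ) :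
    ∫ τ in a..b, radialDeriv u τ = (H (exp (b * I))).im - (H (exp (a * I))).im := by
  have hmem := exp_mul_I_mem_openAnnulus hρ
  have ho := isOpen_openAnnulus ρ⁻¹ ρ
  have hexp : Continuous fun τ : ℝ => exp (τ * I) := by fun_prop
  have hcont : Continuous fun τ : ℝ => (deriv H (exp (τ * I)) * exp (τ * I)).re := by
    refine continuous_re.comp (Continuous.mul ?_ hexp)
    exact (hH.deriv ho).continuousOn.comp_continuous hexp hmem
  simp only [radialDeriv_eq hρ hH hu]
  refine intervalIntegral.integral_eq_sub_of_hasDerivAt (f := fun τ : ℝ => (H (exp (τ * I))).im)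
    (fun τ _ => ?_) (hcont.intervalIntegrable _ _)
  have h1 := (hH.differentiableAt (ho.mem_nhds (hmem τ))).hasDerivAt.comp τ (hasDerivAt_exp_mul_I τ)
  have h2 := imCLM.hasFDerivAt.comp_hasDerivAt τ h1
  refine h2.congr_deriv ?_
  rw [imCLM_apply, ← mul_assoc, mul_I_im]

/-! ### The representation formula -/

/-- Representation of the solution of the Neumann problem on the ellipse `E_ρ` through the solution
of a Dirichlet problem on the annulus `{1/ρ < |w| < ρ}`. -/
theorem mainTheorem9 (ρ : ℝ) (hρ : 1 < ρ) (f : ℂ → ℝ)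
    (hf : ContinuousOn f (frontier (ellipseRegion ρ)))
    (hf0 : ∫ z in frontier (ellipseRegion ρ), f z ∂(MeasureTheory.Measure.hausdorffMeasure 1) = 0)
    (U : ℂ → ℝ) (hU : IsNeumannSolution (ellipseRegion ρ) (ellipseNormal ρ) f U) (hU1 : U 1 = 0) :
    (∃ u : ℂ → ℝ, IsDirichletSolution (openAnnulus ρ⁻¹ ρ) (annulusData ρ f) u) ∧
    ∀ u : ℂ → ℝ, IsDirichletSolution (openAnnulus ρ⁻¹ ρ) (annulusData ρ f) u →
      ∀ z ∈ ellipseRegion ρ, ∀ R Θ : ℝ,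
        R = ‖joukowskyInvPlus z‖ → Θ = Complex.arg (joukowskyInvPlus z) →
        U z = (∫ t in R⁻¹..1, u (t * joukowskyInvPlus z) / t)
          - Θ * ∫ t in (0 : ℝ)..1, ∫ τ in (0 : ℝ)..(t * Θ), radialDeriv u τ := by
  obtain ⟨hharm, G, hGc, hG, hGf⟩ := hU
  have hsol := isDirichletSolution_pullbackGradient_re hρ hharm hGc hG hGf
  refine ⟨⟨_, hsol⟩, fun u hu z hz R Θ hR hΘ => ?_⟩
  have ho := isOpen_openAnnulus ρ⁻¹ ρ
  have heq := hu.eqOn ho (isBounded_openAnnulus ρ⁻¹ ρ) hsol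
  have hH := differentiableOn_pullbackGradient hρ hharm hG
  have hmem := exp_mul_I_mem_openAnnulus hρ
  have hJ : joukowsky (joukowskyInvPlus z) = z :=
    joukowsky_bijOn_plus.surjOn.rightInvOn_invFunOn (Set.mem_univ z)
  have hdom : joukowskyInvPlus z ∈ joukowskyDomPlus :=
    joukowsky_bijOn_plus.surjOn.mapsTo_invFunOn (Set.mem_univ z)
  set w := joukowskyInvPlus z
  have hR1 : 1 ≤ R := hR ▸ hdom.1
  have hR0 : 0 < R := by linarith
  have hw0 : w ≠ 0 := norm_pos_iff.1 (hR ▸ hR0)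
  have hwA : w ∈ openAnnulus ρ⁻¹ ρ := (joukowsky_mem_ellipseRegion_iff hρ hw0).1 (by rwa [hJ])
  have hpolar : (R⁻¹ : ℝ) * w = exp (Θ * I) := by
    have h := norm_mul_exp_arg_mul_I w
    rw [← hR, ← hΘ] at h
    rw [← h, ← mul_assoc, ← ofReal_mul, inv_mul_cancel₀ hR0.ne', ofReal_one, one_mul]
  -- On this segment the modulus runs from 1 to R < ρ, so it stays inside the open annulus.
  have hray : ∀ t ∈ Set.uIcc R⁻¹ 1, 0 < t ∧ (t : ℂ) * w ∈ openAnnulus ρ⁻¹ ρ := by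
    intro t ht
    rw [Set.uIcc_of_le (inv_le_one_of_one_le₀ hR1)] at ht
    have ht0 : 0 < t := (inv_pos.2 hR0).trans_le ht.1
    have h1 : 1 ≤ t * R := by
      have := mul_le_mul_of_nonneg_right ht.1 hR0.le
      rwa [inv_mul_cancel₀ hR0.ne'] at this
    have h2 : t * R ≤ R := by nlinarith [ht.2]
    have h3 : R < ρ := hR ▸ hwA.2
    have hnorm : ‖(t : ℂ) * w‖ = t * R := by
      rw [norm_mul, Complex.norm_of_nonneg ht0.le, ← hR]
    refine ⟨ht0, ?_⟩
    simp only [openAnnulus, Set.mem_ofPred_eq, hnorm]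
    exact ⟨(inv_lt_one_of_one_lt₀ hρ).trans_le h1, h2.trans_lt h3⟩
  have hradial : ∫ t in R⁻¹..1, u (t * w) / t = U z - U (joukowsky (exp (Θ * I))) := by
    have h := intervalIntegral.integral_eq_sub_of_hasDerivAt
      (f := fun t : ℝ => U (joukowsky (t * w))) (f' := fun t : ℝ => u (t * w) / t)
      (a := R⁻¹) (b := 1) (fun t ht => ?_) ?_
    · rw [h, hpolar, ofReal_one, one_mul, hJ]
    · obtain ⟨ht0, htA⟩ := hray t ht
      have h1 : HasDerivAt (fun t : ℝ => (t : ℂ) * w) w t := by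
        simpa using (hasDerivAt_id t).ofReal_comp.mul_const w
      refine (hasDerivAt_comp_joukowsky hρ hG h1 htA).congr_deriv ?_
      have htc : (t : ℂ) ≠ 0 := ofReal_ne_zero.2 ht0.ne'
      rw [heq htA, mul_div_mul_right _ _ hw0, div_ofReal_re]
    · refine ContinuousOn.intervalIntegrable (ContinuousOn.div ?_ continuousOn_id
        fun t ht => (hray t ht).1.ne')
      exact (hu.continuousOn.mono subset_closure).comp (by fun_prop) fun t ht => (hray t ht).2
  have hH1 : (pullbackGradient G (exp ((0 : ℝ) * I))).im = 0 := by simp [pullbackGradient]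
  have hang : Θ * ∫ t in (0 : ℝ)..1, ∫ τ in (0 : ℝ)..(t * Θ), radialDeriv u τ =
      -U (joukowsky (exp (Θ * I))) := by
    simp only [integral_radialDeriv hρ hH heq, hH1, sub_zero]
    -- With Θ inside, the integrand is the t-derivative of -U(J(e^{itΘ})), whose value at t = 0 is
    -- -U(1) = 0.
    rw [← intervalIntegral.integral_const_mul]
    have h := intervalIntegral.integral_eq_sub_of_hasDerivAt
      (f := fun t : ℝ => -U (joukowsky (exp ((t * Θ : ℝ) * I))))
      (f' := fun t : ℝ => Θ * (pullbackGradient G (exp ((t * Θ : ℝ) * I))).im)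
      (a := 0) (b := 1) (fun t _ => ?_) ?_
    · rw [h]
      simp [joukowsky, hU1]
    · have h1 : HasDerivAt (fun t : ℝ => exp ((t * Θ : ℝ) * I))
          (Θ • (exp ((t * Θ : ℝ) * I) * I)) t :=
        HasDerivAt.scomp (g₁ := fun s : ℝ => exp (s * I)) (h := fun s => s * Θ) t
          (hasDerivAt_exp_mul_I (t * Θ)) (hasDerivAt_mul_const Θ)
      refine (hasDerivAt_comp_joukowsky hρ hG h1 (hmem _)).neg.congr_deriv ?_
      have he := exp_ne_zero ((t * Θ : ℝ) * I)
      have : pullbackGradient G (exp ((t * Θ : ℝ) * I)) * (Θ • (exp ((t * Θ : ℝ) * I) * I)) /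
          exp ((t * Θ : ℝ) * I) = Θ * (pullbackGradient G (exp ((t * Θ : ℝ) * I)) * I) := by
        rw [real_smul]
        field_simp
      rw [this, re_ofReal_mul, mul_I_re]
      ring
    · refine Continuous.intervalIntegrable (continuous_const.mul (continuous_im.comp ?_)) _ _
      exact hH.continuousOn.comp_continuous (by fun_prop) fun t => hmem _
  rw [hradial, hang]
  ring
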